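/- Let $K$ be an algebraically closed field that is complete with respect to a nontrivial nonarchimedean absolute value $|\cdot|$, let $\|x\|=\max_i|x_i|$ on $K^{N+1}$, and equip $\mathbb{P}^N(K)$ with the chordal metric $$\Delta(P,Q)=\frac{\max_{0\le i,j\le N}|x_iy_j-x_jy_i|}{\|x\|\,\|y\|}\qquad(P=[x],\ Q=[y]),$$ and write $D_r(P)=\{Q\in\mathbb{P}^N(K):\Delta(P,Q)<r\}$. Let $\varphi:\mathbb{P}^N_K\to\mathbb{P}^N_K$ be a morphism of degree $d\ge 2$. A lift of $\varphi$ is a tuple $\Phi=(\Phi_0,\dots,\Phi_N)$ of homogeneous polynomials of degree $d$ in $K[X_0,\dots,X_N]$ without nontrivial common zero that induces $\varphi$; $\|\Phi\|$ denotes the maximum of the absolute values of the coefficients of $\Phi_0,\dots,\Phi_N$, and $\Phi$ is a minimal lift if $\|\Phi\|=1$. Let $|\operatorname{Res}(\varphi)|$ be the absolute value of the Macaulay resultant of a minimal lift of $\varphi$ (it does not depend on the minimal lift). For a lift $\Phi$ put $g_\Phi(P)=\frac1d\log\|\Phi(x)\|-\log\|x\|$, where $P=[x]$. The morphism $\varphi$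 has good reduction at $P$ if there are a lift $\Phi$ of $\varphi$ and a lift $x$ of $P$ with $\|x\|=\|\Phi\|=\|\Phi(x)\|=1$; let $U^{\mathrm{good}}(\varphi)$ be the set of all such points $P$. Let $\Phi$ be a minimal lift of $\varphi$ and let $P\in\mathbb{P}^N(K)$. Consider the statements: (a) $P\in U^{\mathrm{good}}(\varphi)$. (b) $D_{|\operatorname{Res}(\varphi)|}(P)\subset U^{\mathrm{good}}(\varphi)$. (c) $g_\Phi(P)=0$. (d) $\Delta(\varphi(Q),\varphi(R))\le\Delta(Q,R)$ for all $Q,R\in D_{|\operatorname{Res}(\varphi)|}(P)$. (e) There is a neighborhood $U$ of $P$ such that $\Delta(\varphi(Q),\varphi(R))\le\Delta(Q,R)$ for all $Q,R\in U$. Then (a) $\Leftrightarrow$ (b) $\Leftrightarrow$ (c) $\Rightarrow$ (d) $\Rightarrow$ (e). In particular, $U^{\mathrm{good}}(\varphi)$ is an open subset of $\mathbb{P}^N(K)$. -/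

import Mathlib

open scoped LinearAlgebra.Projectivization

noncomputable section

namespace GoodReduction

/-! ### Projective space over a nonarchimedean field and the chordal metric -/

/-- `ℙ^N(K)`: lines in `K^{N+1}`. Vectors of `K^{N+1}` carry the sup norm. -/
abbrev PSpace (K : Type*) [Field K] (N : ℕ) : Type _ := ℙ K (Fin (N + 1) → K)

/-- The chordal distance computed on vectors: the maximum over `i`, `j` of
`|x_i y_j - x_j y_i|`, divided by `‖x‖ ‖y‖`. -/
def chordalAux {K : Type*} [NormedField K] {N : ℕ} (x y : Fin (N + 1) → K) : ℝ :=
  ‖fun p : Fin (N + 1) × Fin (N + 1) => x p.1 * y p.2 - x p.2 * y p.1‖ / (‖x‖ * ‖y‖)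

theorem chordalAux_smul_smul {K : Type*} [NormedField K] {N : ℕ} (a b : Kˣ)
    (x y : Fin (N + 1) → K) : chordalAux (a • x) (b • y) = chordalAux x y := by
  have ha : ‖(a : K)‖ ≠ 0 := norm_ne_zero_iff.2 a.ne_zero
  have hb : ‖(b : K)‖ ≠ 0 := norm_ne_zero_iff.2 b.ne_zero
  have h : (fun p : Fin (N + 1) × Fin (N + 1) =>
      (a • x) p.1 * (b • y) p.2 - (a • x) p.2 * (b • y) p.1) =
      ((a : K) * (b : K)) • fun p : Fin (N + 1) × Fin (N + 1) =>
        x p.1 * y p.2 - x p.2 * y p.1 := by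
    funext p
    simp only [Pi.smul_apply, Units.smul_def, smul_eq_mul]
    ring
  unfold chordalAux
  rw [h, norm_smul, norm_mul, Units.smul_def, Units.smul_def, norm_smul, norm_smul,
    show ‖(a : K)‖ * ‖x‖ * (‖(b : K)‖ * ‖y‖) = (‖(a : K)‖ * ‖(b : K)‖) * (‖x‖ * ‖y‖) by ring,
    mul_div_mul_left _ _ (mul_ne_zero ha hb)]

/-- The chordal distance `Δ(P, Q)` on `ℙ^N(K)`. -/
def chordalDist {K : Type*} [NormedField K] {N : ℕ} (P Q : PSpace K N) : ℝ :=
  chordalAux P.rep Q.rep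

/-- The chordal distance may be computed with any lifts. -/
theorem chordalDist_mk {K : Type*} [NormedField K] {N : ℕ} (x y : Fin (N + 1) → K)
    (hx : x ≠ 0) (hy : y ≠ 0) :
    chordalDist (Projectivization.mk K x hx) (Projectivization.mk K y hy) = chordalAux x y := by
  obtain ⟨a, ha⟩ := Projectivization.exists_smul_eq_mk_rep K x hx
  obtain ⟨b, hb⟩ := Projectivization.exists_smul_eq_mk_rep K y hy
  rw [chordalDist, ← ha, ← hb, chordalAux_smul_smul]

theorem chordalAux_comm {K : Type*} [NormedField K] {N : ℕ} (x y : Fin (N + 1) → K) :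
    chordalAux x y = chordalAux y x := by
  unfold chordalAux
  rw [mul_comm ‖x‖, ← norm_neg]
  congr 2
  funext p
  simp only [Pi.neg_apply]
  ring

theorem le_chordalAux {K : Type*} [NormedField K] {N : ℕ} (x y : Fin (N + 1) → K)
    (i j : Fin (N + 1)) :
    ‖x i * y j - x j * y i‖ ≤ chordalAux x y * (‖x‖ * ‖y‖) := by
  by_cases hx : x = 0
  · simp [hx]
  by_cases hy : y = 0
  · simp [hy]
  unfold chordalAux
  rw [div_mul_cancel₀ _ (mul_ne_zero (norm_ne_zero_iff.2 hx) (norm_ne_zero_iff.2 hy))]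
  exact norm_le_pi_norm (fun p : Fin (N + 1) × Fin (N + 1) => x p.1 * y p.2 - x p.2 * y p.1) (i, j)

/-- The strong triangle inequality for the chordal distance. -/
theorem chordalAux_triangle {K : Type*} [NormedField K] [IsUltrametricDist K] {N : ℕ}
    (x y z : Fin (N + 1) → K) (hx : x ≠ 0) (hy : y ≠ 0) (hz : z ≠ 0) :
    chordalAux x z ≤ max (chordalAux x y) (chordalAux y z) := by
  obtain ⟨j, hj⟩ : ∃ j, ‖y‖ = ‖y j‖ := by
    obtain ⟨j, -, hj⟩ := Finset.exists_mem_eq_sup' Finset.univ_nonempty fun j => ‖y j‖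
    refine ⟨j, le_antisymm ?_ (norm_le_pi_norm y j)⟩
    rw [pi_norm_le_iff_of_nonneg (norm_nonneg _)]
    intro i
    rw [← hj]
    exact Finset.le_sup' (fun j => ‖y j‖) (Finset.mem_univ i)
  have hx' := norm_pos_iff.2 hx
  have hy' := norm_pos_iff.2 hy
  have hz' := norm_pos_iff.2 hz
  set M := max (chordalAux x y) (chordalAux y z) with hM
  have hM0 : 0 ≤ M := le_max_of_le_left (by unfold chordalAux; positivity)
  rw [chordalAux, div_le_iff₀ (mul_pos hx' hz')]
  rw [pi_norm_le_iff_of_nonneg (by positivity)]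
  rintro ⟨i, k⟩
  have key : (x i * z k - x k * z i) * y j =
      (x i * y j - x j * y i) * z k + (y i * z k - y k * z i) * x j
        + (x j * y k - x k * y j) * z i := by ring
  have h1 : ∀ a b c : Fin (N + 1), ‖(x a * y b - x b * y a) * z c‖ ≤ M * (‖x‖ * ‖z‖) * ‖y‖ := by
    intro a b c
    rw [norm_mul]
    calc ‖x a * y b - x b * y a‖ * ‖z c‖ ≤ (chordalAux x y * (‖x‖ * ‖y‖)) * ‖z‖ :=
          mul_le_mul (le_chordalAux x y a b) (norm_le_pi_norm z c) (norm_nonneg _)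
            ((norm_nonneg _).trans (le_chordalAux x y a b))
      _ ≤ (M * (‖x‖ * ‖y‖)) * ‖z‖ := by gcongr; exact le_max_left _ _
      _ = _ := by ring
  have h2 : ‖(y i * z k - y k * z i) * x j‖ ≤ M * (‖x‖ * ‖z‖) * ‖y‖ := by
    rw [norm_mul]
    calc ‖y i * z k - y k * z i‖ * ‖x j‖ ≤ (chordalAux y z * (‖y‖ * ‖z‖)) * ‖x‖ :=
          mul_le_mul (le_chordalAux y z i k) (norm_le_pi_norm x j) (norm_nonneg _)
            ((norm_nonneg _).trans (le_chordalAux y z i k))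
      _ ≤ (M * (‖y‖ * ‖z‖)) * ‖x‖ := by gcongr; exact le_max_right _ _
      _ = _ := by ring
  have h3 : ‖(x i * z k - x k * z i) * y j‖ ≤ M * (‖x‖ * ‖z‖) * ‖y‖ := by
    rw [key]
    refine (IsUltrametricDist.norm_add_le_max _ _).trans (max_le ?_ (h1 _ _ _))
    exact (IsUltrametricDist.norm_add_le_max _ _).trans (max_le (h1 _ _ _) h2)
  rw [norm_mul, ← hj] at h3
  exact le_of_mul_le_mul_right h3 hy'

/-- `ℙ^N(K)` as a metric space, with the chordal metric. -/
instance chordalMetric {K : Type*} [NormedField K] [IsUltrametricDist K] {N : ℕ} :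
    MetricSpace (PSpace K N) where
  dist := chordalDist
  dist_self P := by
    have : (fun p : Fin (N + 1) × Fin (N + 1) =>
        P.rep p.1 * P.rep p.2 - P.rep p.2 * P.rep p.1) = 0 := by
      funext p
      simp [mul_comm]
    simp [chordalDist, chordalAux, this]
  dist_comm P Q := chordalAux_comm _ _
  dist_triangle P Q R := by
    refine (chordalAux_triangle P.rep Q.rep R.rep P.rep_nonzero Q.rep_nonzero
      R.rep_nonzero).trans (max_le_add_of_nonneg ?_ ?_) <;>
    · unfold chordalAux
      positivity
  eq_of_dist_eq_zero {P Q} h := by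
    have hz : ∀ i j, P.rep i * Q.rep j = P.rep j * Q.rep i := by
      intro i j
      have h' := le_chordalAux P.rep Q.rep i j
      rw [show chordalAux P.rep Q.rep = 0 from h, zero_mul] at h'
      exact sub_eq_zero.1 (norm_le_zero_iff.1 h')
    obtain ⟨j, hj⟩ := Function.ne_iff.1 Q.rep_nonzero
    rw [← P.mk_rep, ← Q.mk_rep, Projectivization.mk_eq_mk_iff']
    refine ⟨P.rep j / Q.rep j, ?_⟩
    funext i
    simp only [Pi.smul_apply, smul_eq_mul]
    rw [div_mul_eq_mul_div, ← hz, mul_div_assoc, div_self hj, mul_one]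

theorem dist_eq_chordalDist {K : Type*} [NormedField K] [IsUltrametricDist K] {N : ℕ}
    (P Q : PSpace K N) : dist P Q = chordalDist P Q := rfl

/-- The open disk `D_r(P) = {Q : Δ(P, Q) < r}`. -/
def disk {K : Type*} [NormedField K] {N : ℕ} (P : PSpace K N) (r : ℝ) : Set (PSpace K N) :=
  {Q | chordalDist P Q < r}

/-! ### Morphisms of projective space and their lifts -/

/-- The map `K^{N+1} → K^{N+1}` given by an `(N+1)`-tuple of polynomials. -/
def evalMap {K : Type*} [Field K] {N : ℕ} (Φ : Fin (N + 1) → MvPolynomial (Fin (N + 1)) K)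
    (x : Fin (N + 1) → K) : Fin (N + 1) → K :=
  fun i => MvPolynomial.eval x (Φ i)

/-- `Φ` is a lift of degree `d` of the self-map `f` of `ℙ^N(K)`: its components are homogeneous
of degree `d`, have no common zero other than the origin, and `f [x] = [Φ(x)]`. -/
def IsLift {K : Type*} [Field K] {N : ℕ} (d : ℕ)
    (Φ : Fin (N + 1) → MvPolynomial (Fin (N + 1)) K) (f : PSpace K N → PSpace K N) : Prop :=
  (∀ i, (Φ i).IsHomogeneous d) ∧
    ∀ (x : Fin (N + 1) → K) (hx : x ≠ 0), ∃ h : evalMap Φ x ≠ 0,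
      f (Projectivization.mk K x hx) = Projectivization.mk K (evalMap Φ x) h

/-- Morphisms `ℙ^N → ℙ^N` of degree `d` over an algebraically closed field `K`, given by their
(determining) action on the `K`-points: the maps induced by `N+1` forms of degree `d` without
nontrivial common zero. -/
structure ProjMorphism (K : Type*) [Field K] (N d : ℕ) where
  /-- the action on points -/
  toFun : PSpace K N → PSpace K N
  exists_lift : ∃ Φ : Fin (N + 1) → MvPolynomial (Fin (N + 1)) K, IsLift d Φ toFun

/-- The norm `‖Φ‖`: the maximum of the absolute values of all the coefficients of `Φ`. -/
def coeffNorm {K : Type*} [NormedField K] {N : ℕ}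
    (Φ : Fin (N + 1) → MvPolynomial (Fin (N + 1)) K) : ℝ :=
  ((Finset.univ.sup fun i => (Φ i).support.sup fun α => ‖(Φ i).coeff α‖₊ : NNReal) : ℝ)

/-- A minimal lift: all coefficients are `K`-integral and at least one is a `K`-unit. -/
def IsMinimalLift {K : Type*} [NormedField K] {N d : ℕ} (φ : ProjMorphism K N d)
    (Φ : Fin (N + 1) → MvPolynomial (Fin (N + 1)) K) : Prop :=
  IsLift d Φ φ.toFun ∧ (∀ i α, ‖(Φ i).coeff α‖ ≤ 1) ∧ ∃ i α, ‖(Φ i).coeff α‖ = 1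

/-! ### The Macaulay resultant of `N+1` forms of degree `d` in `N+1` variables -/

/-- The exponents of degree `d` in `N+1` variables. -/
abbrev Expo (N d : ℕ) : Type :=
  ((Finset.univ : Finset (Fin (N + 1))).finsuppAntidiag d : Finset (Fin (N + 1) →₀ ℕ))

/-- `ℤ[u]`, one indeterminate `u_{i,α}` for each coefficient of `N+1` forms of degree `d`. -/
abbrev CoeffRing (N d : ℕ) : Type := MvPolynomial (Fin (N + 1) × Expo N d) ℤ

/-- The generic form `F_i = ∑_α u_{i,α} X^α` of degree `d`. -/
def genericForm (N d : ℕ) (i : Fin (N + 1)) : MvPolynomial (Fin (N + 1)) (CoeffRing N d) :=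
  ∑ α : Expo N d, MvPolynomial.monomial (α : Fin (N + 1) →₀ ℕ) (MvPolynomial.X (i, α))

/-- The resultant ideal (inertia forms of degree `0`): all `a ∈ ℤ[u]` such that `a X_j^k`, for
some `k` and all `j`, lies in the ideal of `ℤ[u][X]` generated by the generic forms. -/
def resultantIdeal (N d : ℕ) : Ideal (CoeffRing N d) where
  carrier := {a | ∃ k : ℕ, ∀ j : Fin (N + 1),
    MvPolynomial.C a * MvPolynomial.X j ^ k ∈ Ideal.span (Set.range (genericForm N d))}
  zero_mem' := ⟨0, fun j => by simp⟩
  add_mem' := by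
    rintro a b ⟨k, hk⟩ ⟨l, hl⟩
    refine ⟨k + l, fun j => ?_⟩
    have h1 := Ideal.mul_mem_right (MvPolynomial.X j ^ l) _ (hk j)
    have h2 := Ideal.mul_mem_right (MvPolynomial.X j ^ k) _ (hl j)
    convert add_mem h1 h2 using 1
    rw [map_add]
    ring
  smul_mem' := by
    rintro c a ⟨k, hk⟩
    refine ⟨k, fun j => ?_⟩
    convert Ideal.mul_mem_left _ (MvPolynomial.C c) (hk j) using 1
    rw [smul_eq_mul, map_mul, mul_assoc]

/-- The elements of the resultant ideal have a greatest common divisor. -/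
theorem exists_gcd_resultantIdeal (N d : ℕ) :
    ∃ g : CoeffRing N d, ∀ b, b ∣ g ↔ ∀ a ∈ resultantIdeal N d, b ∣ a := by
  classical
  obtain ⟨S, hS⟩ := (isNoetherianRing_iff_ideal_fg _).1
    (inferInstance : IsNoetherianRing (CoeffRing N d)) (resultantIdeal N d)
  let _ : StrongNormalizationMonoid (CoeffRing N d) :=
    UniqueFactorizationMonoid.strongNormalizationMonoid
  let _ : NormalizedGCDMonoid (CoeffRing N d) :=
    UniqueFactorizationMonoid.toNormalizedGCDMonoid _
  refine ⟨S.gcd id, fun b => ?_⟩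
  rw [Finset.dvd_gcd_iff]
  constructor
  · intro h a ha
    rw [← Ideal.mem_span_singleton]
    refine (?_ : resultantIdeal N d ≤ Ideal.span {b}) ha
    rw [← hS, Ideal.span_le]
    exact fun s hs => Ideal.mem_span_singleton.2 (h s hs)
  · intro h s hs
    exact h s (hS ▸ Ideal.subset_span hs)

/-- A greatest common divisor of the resultant ideal. The resultant ideal is principal and the
Macaulay resultant is its generator, so this is the Macaulay resultant up to sign. -/
def preResultant (N d : ℕ) : CoeffRing N d := (exists_gcd_resultantIdeal N d).choose

theorem dvd_preResultant_iff (N d : ℕ) (b : CoeffRing N d) :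
    b ∣ preResultant N d ↔ ∀ a ∈ resultantIdeal N d, b ∣ a :=
  (exists_gcd_resultantIdeal N d).choose_spec b

/-- The value of `q ∈ ℤ[u]` at the coefficients of the tuple `Φ`. -/
def evalCoeffs {R : Type*} [CommRing R] {N d : ℕ} (q : CoeffRing N d)
    (Φ : Fin (N + 1) → MvPolynomial (Fin (N + 1)) R) : R :=
  MvPolynomial.aeval (fun p : Fin (N + 1) × Expo N d =>
    (Φ p.1).coeff (p.2 : Fin (N + 1) →₀ ℕ)) q

/-- The Macaulay resultant in `ℤ[u]`, with the sign such that its value at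
`(X_0^d, …, X_N^d)` is not negative (that value is `1`). -/
def resultantPoly (N d : ℕ) : CoeffRing N d :=
  if evalCoeffs (R := ℤ) (preResultant N d) (fun i => MvPolynomial.X i ^ d) < 0
  then -preResultant N d else preResultant N d

/-- `Res(Φ)`, for a tuple `Φ` of `N+1` forms of degree `d` in `N+1` variables. -/
def resultant {K : Type*} [Field K] {N : ℕ} (d : ℕ)
    (Φ : Fin (N + 1) → MvPolynomial (Fin (N + 1)) K) : K :=
  evalCoeffs (resultantPoly N d) Φ

/-- `ρ` is a minimal resultant `Res(φ)` of `φ`: the resultant of a minimal lift. -/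
def IsMinimalResultant {K : Type*} [NormedField K] {N d : ℕ} (φ : ProjMorphism K N d)
    (ρ : K) : Prop :=
  ∃ Φ, IsMinimalLift φ Φ ∧ resultant d Φ = ρ

/-! ### Good reduction and the function `g_Φ` -/

/-- `φ` has good reduction at `P`: there are a lift `Φ` of `φ` and a lift `x` of `P` with
`‖x‖ = 1`, `‖Φ‖ = 1` and `‖Φ(x)‖ = 1`. -/
def HasGoodReductionAt {K : Type*} [NormedField K] {N d : ℕ} (φ : ProjMorphism K N d)
    (P : PSpace K N) : Prop :=
  ∃ Φ : Fin (N + 1) → MvPolynomial (Fin (N + 1)) K, IsLift d Φ φ.toFun ∧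
    ∃ (x : Fin (N + 1) → K) (hx : x ≠ 0), Projectivization.mk K x hx = P ∧
      ‖x‖ = 1 ∧ coeffNorm Φ = 1 ∧ ‖evalMap Φ x‖ = 1

/-- `U^good(φ)`, the set of points of good reduction. -/
def goodLocus {K : Type*} [NormedField K] {N d : ℕ} (φ : ProjMorphism K N d) :
    Set (PSpace K N) :=
  {P | HasGoodReductionAt φ P}

/-- `g_Φ(P) = (1/d) log ‖Φ(x)‖ - log ‖x‖`, for a lift `x` of `P`. -/
def gFun {K : Type*} [NormedField K] {N : ℕ} (d : ℕ)
    (Φ : Fin (N + 1) → MvPolynomial (Fin (N + 1)) K) (P : PSpace K N) : ℝ :=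
  (1 / (d : ℝ)) * Real.log ‖evalMap Φ P.rep‖ - Real.log ‖P.rep‖

theorem evalMap_smul {K : Type*} [Field K] {N d : ℕ}
    {Φ : Fin (N + 1) → MvPolynomial (Fin (N + 1)) K} (hΦ : ∀ i, (Φ i).IsHomogeneous d)
    (c : K) (x : Fin (N + 1) → K) : evalMap Φ (c • x) = c ^ d • evalMap Φ x := by
  funext i
  simp only [evalMap, Pi.smul_apply, smul_eq_mul, MvPolynomial.eval_eq, Finset.mul_sum]
  refine Finset.sum_congr rfl fun α hα => ?_
  have hd : ∑ j ∈ α.support, α j = d := by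
    have := hΦ i (MvPolynomial.mem_support_iff.1 hα)
    rwa [Finsupp.weight_apply, Finsupp.sum, Finset.sum_congr rfl fun j _ => by
      rw [Pi.one_apply, smul_eq_mul, mul_one]] at this
  rw [← hd, ← Finset.prod_pow_eq_pow_sum]
  simp only [mul_pow, Finset.prod_mul_distrib]
  ring

/-- `g_Φ(P)` may be computed with any lift of `P`. -/
theorem gFun_mk {K : Type*} [NormedField K] {N d : ℕ} (hd : d ≠ 0)
    {Φ : Fin (N + 1) → MvPolynomial (Fin (N + 1)) K} {f : PSpace K N → PSpace K N}
    (hΦ : IsLift d Φ f) (x : Fin (N + 1) → K) (hx : x ≠ 0) :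
    gFun d Φ (Projectivization.mk K x hx) =
      (1 / (d : ℝ)) * Real.log ‖evalMap Φ x‖ - Real.log ‖x‖ := by
  obtain ⟨a, ha⟩ := Projectivization.exists_smul_eq_mk_rep K x hx
  have ha0 : ‖(a : K)‖ ≠ 0 := norm_ne_zero_iff.2 a.ne_zero
  have hd0 : (d : ℝ) ≠ 0 := Nat.cast_ne_zero.2 hd
  obtain ⟨h, -⟩ := hΦ.2 x hx
  rw [gFun, ← ha, Units.smul_def, evalMap_smul hΦ.1, norm_smul, norm_smul, norm_pow,
    Real.log_mul (pow_ne_zero _ ha0) (norm_ne_zero_iff.2 h),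
    Real.log_mul ha0 (norm_ne_zero_iff.2 hx), Real.log_pow]
  field_simp
  ring

/-- `φ` is nonexpanding on `U` for the chordal metric. -/
def NonexpandingOn {K : Type*} [NormedField K] {N d : ℕ} (φ : ProjMorphism K N d)
    (U : Set (PSpace K N)) : Prop :=
  ∀ Q ∈ U, ∀ R ∈ U, chordalDist (φ.toFun Q) (φ.toFun R) ≤ chordalDist Q R

end GoodReduction

end

open GoodReduction

namespace GoodReduction

open MvPolynomial

/-! ### Lifts: Nullstellensatz and uniqueness up to a scalar -/

/-! Good reduction is an open condition because a minimal lift Φ has integral coefficients. By the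
ultrametric inequality, x ↦ Φ(x) is nonexpanding on the closed unit polydisk, so ‖Φ(x)‖ = 1 survives
a perturbation of x of norm less than 1 (`norm_evalMap_eq_one_of_norm_sub_lt`). Representatives
normalized to have the same coordinate equal to 1 satisfy ‖y - z‖ ≤ Δ(Q, R). Good reduction at P
therefore spreads to the whole disk D_1(P) (`disk_one_subset_goodLocus`), and there φ is
nonexpanding (`nonexpandingOn_disk_one`), since the 2×2 minors of unit vectors u, v are bounded by
‖u - v‖.

The resultant enters only through 0 < |Res(φ)| ≤ 1: the disk of that radius is a neighborhood of P
inside D_1(P). The upper bound holds since Res is an integer polynomial in integral coefficients.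
For nonvanishing, Res divides every element of the resultant ideal, and a suitable minor of a
Macaulay matrix is such an element and is nonzero at Φ (`IsLift.exists_mem_resultantIdeal`).

Lifts are unique up to a scalar (`IsLift.exists_eq_C_mul`), so good reduction can be read off from
any one minimal lift, which links it to g_Φ(P) = 0. -/

theorem IsLift.evalMap_ne_zero {K : Type*} [Field K] {N d : ℕ}
    {Φ : Fin (N + 1) → MvPolynomial (Fin (N + 1)) K} {f : PSpace K N → PSpace K N}
    (h : IsLift d Φ f) {x : Fin (N + 1) → K} (hx : x ≠ 0) : evalMap Φ x ≠ 0 :=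
  (h.2 x hx).1

/-- A large power of each variable lies in the ideal generated by a lift. -/
theorem IsLift.exists_X_pow_mem {K : Type*} [Field K] [IsAlgClosed K] {N d : ℕ}
    {Φ : Fin (N + 1) → MvPolynomial (Fin (N + 1)) K} {f : PSpace K N → PSpace K N}
    (h : IsLift d Φ f) : ∃ k : ℕ, ∀ j, X j ^ k ∈ Ideal.span (Set.range Φ) := by
  have hrad : ∀ j, (X j : MvPolynomial (Fin (N + 1)) K) ∈
      (Ideal.span (Set.range Φ)).radical := by
    intro j
    rw [← vanishingIdeal_zeroLocus_eq_radical (K := K), mem_vanishingIdeal_iff]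
    intro x hx
    rw [zeroLocus_span] at hx
    have hx0 : x = 0 := by
      by_contra hne
      refine h.evalMap_ne_zero hne (funext fun i => ?_)
      exact hx (Φ i) ⟨i, rfl⟩
    simp [hx0]
  choose k hk using hrad
  refine ⟨∑ j, k j, fun j => ?_⟩
  exact Ideal.pow_mem_of_pow_mem _ (hk j)
    (Finset.single_le_sum (fun _ _ => Nat.zero_le _) (Finset.mem_univ j))

/-- Two lifts take proportional values at each nonzero vector, and both vanish at the origin since d
≠ 0. The 2×2 minors thus vanish at every point, hence as polynomials over an infinite field. -/
theorem IsLift.mul_eq_mul {K : Type*} [Field K] [Infinite K] {N d : ℕ}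
    {Φ Ψ : Fin (N + 1) → MvPolynomial (Fin (N + 1)) K} {f : PSpace K N → PSpace K N}
    (hd : d ≠ 0) (hΦ : IsLift d Φ f) (hΨ : IsLift d Ψ f) (i j : Fin (N + 1)) :
    Φ i * Ψ j = Φ j * Ψ i := by
  refine MvPolynomial.funext fun x => ?_
  by_cases hx : x = 0
  · have h0 : ∀ i, eval x (Φ i) = 0 := fun i => by
      have := congrFun (evalMap_smul hΦ.1 0 x) i
      simpa [evalMap, hx, zero_pow hd] using this
    simp [h0]
  obtain ⟨h1, e1⟩ := hΦ.2 x hx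
  obtain ⟨h2, e2⟩ := hΨ.2 x hx
  obtain ⟨a, ha⟩ := (Projectivization.mk_eq_mk_iff' K _ _ _ _).1 (e1.symm.trans e2)
  have hi : ∀ i, eval x (Φ i) = a * eval x (Ψ i) := fun i => (congrFun ha i).symm
  simp only [map_mul, hi]
  ring

/-- A divisor of a form of the same degree is a scalar multiple of it. -/
theorem eq_C_mul_of_dvd {K σ : Type*} [Field K] {d : ℕ} {p q : MvPolynomial σ K}
    (hp : p.IsHomogeneous d) (hq : q.IsHomogeneous d) (h : p ∣ q) :
    ∃ c : K, q = C c * p := by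
  obtain ⟨r, rfl⟩ := h
  by_cases h0 : p * r = 0
  · exact ⟨0, by simp [h0]⟩
  have hp0 := left_ne_zero_of_mul h0
  have hr0 := right_ne_zero_of_mul h0
  have := hq.totalDegree h0
  rw [totalDegree_mul_of_isDomain hp0 hr0, hp.totalDegree hp0] at this
  refine ⟨r.coeff 0, ?_⟩
  rw [← totalDegree_eq_zero_iff_eq_C.1 (by omega : r.totalDegree = 0), mul_comm]

theorem IsLift.exists_ne_zero {K : Type*} [Field K] {N d : ℕ}
    {Φ : Fin (N + 1) → MvPolynomial (Fin (N + 1)) K} {f : PSpace K N → PSpace K N}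
    (h : IsLift d Φ f) : ∃ i, Φ i ≠ 0 := by
  by_contra! h0
  exact h.evalMap_ne_zero (x := 1) one_ne_zero (funext fun i => by simp [evalMap, h0])

/-- Writing X_j^k = ∑ c_l Φ_l and using Φ_l Ψ_i = Φ_i Ψ_l gives Φ_i ∣ X_j^k Ψ_i for every j. With
two distinct variables the powers cancel because the variables are nonassociated primes. For N = 0
there is only one variable, but then forms are monomials. -/
theorem IsLift.dvd {K : Type*} [Field K] [IsAlgClosed K] {N d : ℕ}
    {Φ Ψ : Fin (N + 1) → MvPolynomial (Fin (N + 1)) K} {f : PSpace K N → PSpace K N}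
    (hd : d ≠ 0) (hΦ : IsLift d Φ f) (hΨ : IsLift d Ψ f) {i : Fin (N + 1)} (hi : Φ i ≠ 0) :
    Φ i ∣ Ψ i := by
  have : Infinite K := IsAlgClosed.instInfinite
  obtain ⟨k, hk⟩ := hΦ.exists_X_pow_mem
  have hdvd : ∀ j, Φ i ∣ X j ^ k * Ψ i := by
    intro j
    obtain ⟨c, hc⟩ := (Ideal.mem_span_range_iff_exists_fun).1 (hk j)
    rw [← hc, Finset.sum_mul]
    refine Finset.dvd_sum fun l _ => ⟨c l * Ψ l, ?_⟩
    rw [mul_assoc, ← hΦ.mul_eq_mul hd hΨ i l]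
    ring
  rcases Nat.eq_zero_or_pos N with rfl | hN
  · have hmon : ∀ p : MvPolynomial (Fin (0 + 1)) K, p.IsHomogeneous d →
        p = monomial (Finsupp.single 0 d) (p.coeff (Finsupp.single 0 d)) := by
      intro p hp
      ext α
      rw [coeff_monomial]
      split_ifs with h
      · rw [h]
      · refine hp.coeff_eq_zero fun hα => h ?_
        ext l
        obtain rfl : l = 0 := Fin.fin_one_eq_zero l
        rw [← hα]
        simp [Finsupp.degree_eq_sum]
    rw [hmon _ (hΦ.1 i), hmon _ (hΨ.1 i)]
    rw [monomial_dvd_monomial]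
    refine ⟨Or.inr le_rfl, ?_⟩
    have h0 : (Φ i).coeff (Finsupp.single 0 d) ≠ 0 := by
      intro h0
      exact hi (by rw [hmon _ (hΦ.1 i), h0, monomial_zero])
    exact (isUnit_iff_ne_zero.2 h0).dvd
  · obtain ⟨A, hA⟩ := hdvd 0
    obtain ⟨B, hB⟩ := hdvd (Fin.last N)
    have h01 : (0 : Fin (N + 1)) ≠ Fin.last N := by
      rw [Ne, Fin.ext_iff]
      simp
      omega
    have hAB : X (Fin.last N) ^ k * A = X 0 ^ k * B := by
      refine mul_left_cancel₀ hi ?_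
      linear_combination X 0 ^ k * hB - X (Fin.last N) ^ k * hA
    have hndvd : ¬ (X 0 : MvPolynomial (Fin (N + 1)) K) ∣ X (Fin.last N) ^ k := by
      intro h
      have := X_prime.dvd_of_dvd_pow h
      rw [X_dvd_X] at this
      exact h01 this
    obtain ⟨E, rfl⟩ := (X_prime (R := K) (i := (0 : Fin (N + 1)))).pow_dvd_of_dvd_mul_left k
      hndvd ⟨B, hAB⟩
    refine ⟨E, mul_left_cancel₀ (pow_ne_zero k (X_ne_zero 0)) ?_⟩
    rw [hA]
    ring

/-- A lift is unique up to a scalar. -/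
theorem IsLift.exists_eq_C_mul {K : Type*} [Field K] [IsAlgClosed K] {N d : ℕ}
    {Φ Ψ : Fin (N + 1) → MvPolynomial (Fin (N + 1)) K} {f : PSpace K N → PSpace K N}
    (hd : d ≠ 0) (hΦ : IsLift d Φ f) (hΨ : IsLift d Ψ f) :
    ∃ c : K, ∀ i, Ψ i = C c * Φ i := by
  have : Infinite K := IsAlgClosed.instInfinite
  obtain ⟨i, hi⟩ := hΦ.exists_ne_zero
  obtain ⟨c, hc⟩ := eq_C_mul_of_dvd (hΦ.1 i) (hΨ.1 i) (hΦ.dvd hd hΨ hi)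
  refine ⟨c, fun j => mul_left_cancel₀ hi ?_⟩
  rw [hΦ.mul_eq_mul hd hΨ i j, hc]
  ring

/-! ### The resultant of a lift does not vanish -/

/-- Each Φ_i is homogeneous, so a term of a coefficient a_i contributes to a single degree of a_i
Φ_i. This turns ideal membership into linear algebra in one fixed degree. -/
theorem homogeneousComponent_mem_span_monomial_mul {K σ ι : Type*} [Field K] {d D : ℕ}
    {Φ : ι → MvPolynomial σ K} (hΦ : ∀ i, (Φ i).IsHomogeneous d)
    {p : MvPolynomial σ K} (hp : p ∈ Ideal.span (Set.range Φ)) :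
    homogeneousComponent D p ∈ Submodule.span K
      {q | ∃ i, ∃ γ : σ →₀ ℕ, γ.degree + d = D ∧ q = monomial γ 1 * Φ i} := by
  have key : ∀ (i : ι) (a : MvPolynomial σ K), homogeneousComponent D (a * Φ i) ∈
      Submodule.span K
        {q | ∃ i, ∃ γ : σ →₀ ℕ, γ.degree + d = D ∧ q = monomial γ 1 * Φ i} := by
    intro i a
    induction a using MvPolynomial.induction_on' with
    | add p q hp hq => rw [add_mul, map_add]; exact add_mem hp hq
    | monomial γ a =>
      rw [homogeneousComponent_of_mem ((isHomogeneous_monomial a rfl).mul (hΦ i))]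
      split_ifs with h
      · have : monomial γ a * Φ i = a • (monomial γ 1 * Φ i) := by
          rw [← smul_mul_assoc, smul_monomial, smul_eq_mul, mul_one]
        rw [this]
        exact Submodule.smul_mem _ _ (Submodule.subset_span ⟨i, γ, h.symm, rfl⟩)
      · exact zero_mem _
  obtain ⟨c, rfl⟩ := Finsupp.mem_ideal_span_range_iff_exists_finsupp.1 hp
  rw [Finsupp.sum, map_sum]
  exact sum_mem fun i _ => key i (c i)

theorem genericForm_isHomogeneous (N d : ℕ) (i : Fin (N + 1)) :
    (genericForm N d i).IsHomogeneous d := by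
  refine IsHomogeneous.sum _ _ _ fun α _ => isHomogeneous_monomial _ ?_
  have := (Finset.mem_finsuppAntidiag.1 α.2).1
  rwa [Finsupp.degree_eq_sum]

theorem mem_expo_iff {N D : ℕ} (α : Fin (N + 1) →₀ ℕ) :
    α ∈ (Finset.univ : Finset (Fin (N + 1))).finsuppAntidiag D ↔ α.degree = D := by
  simp [Finset.mem_finsuppAntidiag, Finsupp.degree_eq_sum]

/-- Specialization of the coefficients of the generic forms. -/
theorem map_genericForm {K : Type*} [Field K] {N d : ℕ}
    {Φ : Fin (N + 1) → MvPolynomial (Fin (N + 1)) K} (hΦ : ∀ i, (Φ i).IsHomogeneous d)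
    (i : Fin (N + 1)) :
    map (aeval (fun p : Fin (N + 1) × Expo N d =>
      (Φ p.1).coeff (p.2 : Fin (N + 1) →₀ ℕ)) : CoeffRing N d →ₐ[ℤ] K).toRingHom
      (genericForm N d i) = Φ i := by
  rw [genericForm, map_sum]
  simp only [map_monomial, AlgHom.toRingHom_eq_coe, RingHom.coe_coe, aeval_X]
  ext β
  rw [coeff_sum]
  simp only [coeff_monomial]
  by_cases hβ : β ∈ (Finset.univ : Finset (Fin (N + 1))).finsuppAntidiag d
  · rw [Finset.sum_eq_single (⟨β, hβ⟩ : Expo N d)]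
    · simp
    · intro b _ hb
      rw [if_neg]
      exact fun h => hb (Subtype.ext h)
    · simp
  · rw [(hΦ i).coeff_eq_zero (by rwa [mem_expo_iff] at hβ)]
    refine Finset.sum_eq_zero fun b _ => if_neg ?_
    rintro rfl
    exact hβ b.2

/-- Some element of the resultant ideal does not vanish at a lift. -/
theorem IsLift.exists_mem_resultantIdeal {K : Type*} [Field K] [IsAlgClosed K] {N d : ℕ}
    {Φ : Fin (N + 1) → MvPolynomial (Fin (N + 1)) K} {f : PSpace K N → PSpace K N}
    (h : IsLift d Φ f) : ∃ a ∈ resultantIdeal N d, evalCoeffs a Φ ≠ 0 := by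
  classical
  obtain ⟨k, hk⟩ := h.exists_X_pow_mem
  -- In degree (N+1)k every monomial has some exponent at least k, so it lies in the ideal of Φ.
  set D := (N + 1) * k with hD
  let coords : MvPolynomial (Fin (N + 1)) K →ₗ[K] (Expo N D → K) :=
    LinearMap.pi fun β => lcoeff K (β : Fin (N + 1) →₀ ℕ)
  let S : Set (MvPolynomial (Fin (N + 1)) K) :=
    {q | ∃ i, ∃ γ : Fin (N + 1) →₀ ℕ, γ.degree + d = D ∧ q = monomial γ 1 * Φ i}
  have hmem : ∀ β : Expo N D, monomial (β : Fin (N + 1) →₀ ℕ) (1 : K) ∈ Submodule.span K S := by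
    intro β
    have hβ : (β : Fin (N + 1) →₀ ℕ).degree = D := (mem_expo_iff _).1 β.2
    obtain ⟨j, hj⟩ : ∃ j, k ≤ (β : Fin (N + 1) →₀ ℕ) j := by
      by_contra! hlt
      have h1 : ∑ j, (β : Fin (N + 1) →₀ ℕ) j < ∑ _j : Fin (N + 1), k :=
        Finset.sum_lt_sum_of_nonempty Finset.univ_nonempty fun j _ => hlt j
      rw [← Finsupp.degree_eq_sum, hβ] at h1
      simp [hD] at h1
    have hI : monomial (β : Fin (N + 1) →₀ ℕ) (1 : K) ∈ Ideal.span (Set.range Φ) := by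
      refine Ideal.mem_of_dvd _ ?_ (hk j)
      rw [X_pow_eq_monomial, monomial_dvd_monomial]
      exact ⟨Or.inr (Finsupp.single_le_iff.2 hj), one_dvd _⟩
    have := homogeneousComponent_mem_span_monomial_mul (D := D) h.1 hI
    rwa [homogeneousComponent_eq_self (isHomogeneous_monomial _ hβ)] at this
  have hspan : Submodule.span K (coords '' S) = ⊤ := by
    rw [eq_top_iff, ← (Pi.basisFun K (Expo N D)).span_eq, Submodule.span_le,
      ← Submodule.map_span]
    rintro _ ⟨β, rfl⟩
    refine ⟨_, hmem β, ?_⟩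
    funext β'
    rw [Pi.basisFun_apply, Pi.single_apply]
    simp only [coords, LinearMap.pi_apply, lcoeff_apply, coeff_monomial, Subtype.ext_iff,
      eq_comm (a := (β' : Fin (N + 1) →₀ ℕ))]
  -- A basis is selected among the monomial multiples of the Φ_i. It has as many members as there
  -- are monomials of degree D, so its coordinate matrix is square.
  obtain ⟨b, hbS, hb, hli⟩ := exists_linearIndependent K (coords '' S)
  rw [hspan] at hb
  let B : Module.Basis b K (Expo N D → K) := Module.Basis.mk hli (by rw [Subtype.range_coe, hb])
  let e : Expo N D ≃ b := (Pi.basisFun K (Expo N D)).indexEquiv B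
  have hpre : ∀ β : Expo N D, ∃ i, ∃ γ : Fin (N + 1) →₀ ℕ, γ.degree + d = D ∧
      coords (monomial γ 1 * Φ i) = e β := by
    intro β
    obtain ⟨q, ⟨i, γ, hγ, rfl⟩, hq⟩ := hbS (e β).2
    exact ⟨i, γ, hγ, hq⟩
  choose ι γ hγ hιγ using hpre
  -- The same multiples taken of the generic forms: a square Macaulay matrix over ℤ[u] that becomes
  -- invertible when specialized at Φ.
  let M : Matrix (Expo N D) (Expo N D) (CoeffRing N d) := Matrix.of fun β t =>
    coeff (β : Fin (N + 1) →₀ ℕ) (monomial (γ t) 1 * genericForm N d (ι t))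
  let ev : CoeffRing N d →+* K := (aeval (fun p : Fin (N + 1) × Expo N d =>
      (Φ p.1).coeff (p.2 : Fin (N + 1) →₀ ℕ)) : CoeffRing N d →ₐ[ℤ] K).toRingHom
  have hMcol : ∀ t, (M.map ev).col t = e t := by
    intro t
    rw [← hιγ t]
    funext β
    simp only [Matrix.col_apply, Matrix.map_apply, M, Matrix.of_apply, coords,
      LinearMap.pi_apply, lcoeff_apply]
    rw [← coeff_map, map_mul, map_genericForm h.1, map_monomial, map_one]
  have hunit : IsUnit (M.map ev) := by
    rw [← Matrix.linearIndependent_cols_iff_isUnit]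
    have : (M.map ev).col = (fun x : b => (x : Expo N D → K)) ∘ e := funext hMcol
    rw [this]
    exact hli.comp _ e.injective
  refine ⟨M.det, ⟨D, fun j => ?_⟩, ?_⟩
  · let β : Expo N D := ⟨Finsupp.single j D, by simp⟩
    -- Cramer's rule: the column of the adjugate at X_j^D expresses det(M) X_j^D through the generic
    -- forms, so the determinant lies in the resultant ideal.
    have key : C M.det * X j ^ D =
        ∑ t, C (M.adjugate t β) * (monomial (γ t) 1 * genericForm N d (ι t)) := by
      refine MvPolynomial.ext _ _ fun α => ?_
      rw [X_pow_eq_monomial, C_mul_monomial, mul_one, coeff_monomial, coeff_sum]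
      simp only [coeff_C_mul]
      by_cases hα : α ∈ (Finset.univ : Finset (Fin (N + 1))).finsuppAntidiag D
      · have := congrFun (congrFun (Matrix.mul_adjugate M) ⟨α, hα⟩) β
        simp only [Matrix.mul_apply, Matrix.smul_apply, Matrix.one_apply, smul_eq_mul,
          mul_ite, mul_one, mul_zero] at this
        simp only [Subtype.ext_iff, M, Matrix.of_apply, β] at this
        simp only [eq_comm (a := Finsupp.single j D)]
        rw [← this]
        exact Finset.sum_congr rfl fun t _ => mul_comm _ _
      · rw [if_neg (by rintro rfl; exact hα β.2), eq_comm]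
        refine Finset.sum_eq_zero fun t _ => ?_
        rw [(((isHomogeneous_monomial 1 rfl).mul
          (genericForm_isHomogeneous N d (ι t))).coeff_eq_zero), mul_zero]
        rw [hγ t]
        rwa [mem_expo_iff] at hα
    rw [key]
    refine Ideal.sum_mem _ fun t _ => ?_
    exact Ideal.mul_mem_left _ _ (Ideal.mul_mem_left _ _ (Ideal.subset_span ⟨_, rfl⟩))
  · have h1 : ev M.det ≠ 0 := by
      rw [RingHom.map_det]
      exact ((Matrix.isUnit_iff_isUnit_det _).1 hunit).ne_zero
    exact h1

/-- The resultant is, up to sign, a common divisor of the resultant ideal, some element of which is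
nonzero at Φ. -/
theorem IsLift.resultant_ne_zero {K : Type*} [Field K] [IsAlgClosed K] {N d : ℕ}
    {Φ : Fin (N + 1) → MvPolynomial (Fin (N + 1)) K} {f : PSpace K N → PSpace K N}
    (h : IsLift d Φ f) : resultant d Φ ≠ 0 := by
  obtain ⟨a, ha, hne⟩ := h.exists_mem_resultantIdeal
  obtain ⟨b, rfl⟩ := (dvd_preResultant_iff N d _).1 dvd_rfl a ha
  have hpre : evalCoeffs (preResultant N d) Φ ≠ 0 := by
    intro h0
    unfold evalCoeffs at h0 hne
    exact hne (by rw [map_mul, h0, zero_mul])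
  unfold resultant resultantPoly
  split_ifs
  · unfold evalCoeffs at hpre ⊢
    rwa [map_neg, neg_ne_zero]
  · exact hpre

/-! ### Forms with integral coefficients -/

section Integral

variable {K : Type*} [NormedField K] [IsUltrametricDist K]

/-- The factors are exchanged one at a time; each exchange costs at most r, and ultrametric errors
do not accumulate. -/
theorem norm_prod_sub_prod_le {ι : Type*} (s : Finset ι) {a b : ι → K} {r : ℝ} (hr : 0 ≤ r)
    (ha : ∀ i, ‖a i‖ ≤ 1) (hb : ∀ i, ‖b i‖ ≤ 1) (hab : ∀ i, ‖a i - b i‖ ≤ r) :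
    ‖∏ i ∈ s, a i - ∏ i ∈ s, b i‖ ≤ r := by
  classical
  induction s using Finset.induction_on with
  | empty => simpa
  | insert i s hi ih =>
    rw [Finset.prod_insert hi, Finset.prod_insert hi,
      show a i * ∏ i ∈ s, a i - b i * ∏ i ∈ s, b i =
        a i * (∏ i ∈ s, a i - ∏ i ∈ s, b i) + (a i - b i) * ∏ i ∈ s, b i by ring]
    refine (IsUltrametricDist.norm_add_le_max _ _).trans (max_le ?_ ?_)
    · rw [norm_mul]
      exact (mul_le_of_le_one_left (norm_nonneg _) (ha i)).trans ih
    · rw [norm_mul, norm_prod]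
      exact (mul_le_of_le_one_right (norm_nonneg _)
        (Finset.prod_le_one (fun _ _ => norm_nonneg _) fun i _ => hb i)).trans (hab i)

theorem norm_eval_le_one {σ : Type*} [Fintype σ] {p : MvPolynomial σ K}
    (hp : ∀ α, ‖p.coeff α‖ ≤ 1) {x : σ → K} (hx : ‖x‖ ≤ 1) : ‖eval x p‖ ≤ 1 := by
  rw [eval_eq']
  refine IsUltrametricDist.norm_sum_le_of_forall_le_of_nonneg zero_le_one fun α _ => ?_
  rw [norm_mul, norm_prod]
  refine mul_le_one₀ (hp α) (Finset.prod_nonneg fun _ _ => norm_nonneg _) ?_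
  refine Finset.prod_le_one (fun _ _ => norm_nonneg _) fun i _ => ?_
  rw [norm_pow]
  exact pow_le_one₀ (norm_nonneg _) ((norm_le_pi_norm x i).trans hx)

/-- A polynomial with integral coefficients is nonexpanding on the closed unit polydisk. -/
theorem norm_eval_sub_eval_le {σ : Type*} [Fintype σ] {p : MvPolynomial σ K}
    (hp : ∀ α, ‖p.coeff α‖ ≤ 1) {x y : σ → K} (hx : ‖x‖ ≤ 1) (hy : ‖y‖ ≤ 1) :
    ‖eval x p - eval y p‖ ≤ ‖x - y‖ := by
  rw [eval_eq', eval_eq', ← Finset.sum_sub_distrib]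
  refine IsUltrametricDist.norm_sum_le_of_forall_le_of_nonneg (norm_nonneg _) fun α _ => ?_
  rw [← mul_sub, norm_mul]
  refine (mul_le_of_le_one_left (norm_nonneg _) (hp α)).trans ?_
  have hx' i : ‖x i‖ ≤ 1 := (norm_le_pi_norm x i).trans hx
  have hy' i : ‖y i‖ ≤ 1 := (norm_le_pi_norm y i).trans hy
  refine norm_prod_sub_prod_le _ (norm_nonneg _) (fun i => ?_) (fun i => ?_) fun i => ?_
  · rw [norm_pow]; exact pow_le_one₀ (norm_nonneg _) (hx' i)
  · rw [norm_pow]; exact pow_le_one₀ (norm_nonneg _) (hy' i)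
  -- A power is a product of constant factors, so the product estimate applies again.
  · have := norm_prod_sub_prod_le (Finset.range (α i)) (norm_nonneg (x - y))
      (a := fun _ => x i) (b := fun _ => y i) (fun _ => hx' i) (fun _ => hy' i)
      fun _ => norm_le_pi_norm (x - y) i
    simpa using this

theorem norm_aeval_int_le_one {σ : Type*} (q : MvPolynomial σ ℤ) {u : σ → K}
    (hu : ∀ i, ‖u i‖ ≤ 1) : ‖aeval u q‖ ≤ 1 := by
  induction q using MvPolynomial.induction_on with
  | C a => simpa using IsUltrametricDist.norm_intCast_le_one K a
  | add p q hp hq =>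
    rw [map_add]
    exact (IsUltrametricDist.norm_add_le_max _ _).trans (max_le hp hq)
  | mul_X p i hp =>
    rw [map_mul, aeval_X, norm_mul]
    exact mul_le_one₀ hp (norm_nonneg _) (hu i)

theorem norm_resultant_le_one {N d : ℕ} {Φ : Fin (N + 1) → MvPolynomial (Fin (N + 1)) K}
    (h : ∀ i α, ‖(Φ i).coeff α‖ ≤ 1) : ‖resultant d Φ‖ ≤ 1 :=
  norm_aeval_int_le_one _ fun p => h p.1 _

end Integral

section Vectors

variable {K : Type*} [NormedField K] {ι : Type*} [Fintype ι] [Nonempty ι]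

theorem exists_norm_apply_eq (x : ι → K) : ∃ j, ‖x j‖ = ‖x‖ := by
  obtain ⟨j, -, hj⟩ := Finset.exists_mem_eq_sup' Finset.univ_nonempty fun j => ‖x j‖
  refine ⟨j, le_antisymm (norm_le_pi_norm x j) ?_⟩
  rw [pi_norm_le_iff_of_nonneg (norm_nonneg _)]
  intro i
  rw [← hj]
  exact Finset.le_sup' (fun j => ‖x j‖) (Finset.mem_univ i)

end Vectors

/-! ### Tuples of integral forms on the unit polydisk -/

section Lifts

variable {K : Type*} [NormedField K] {N d : ℕ}
  {Φ : Fin (N + 1) → MvPolynomial (Fin (N + 1)) K}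

theorem coeffNorm_eq_one_iff :
    coeffNorm Φ = 1 ↔ (∀ i α, ‖(Φ i).coeff α‖ ≤ 1) ∧ ∃ i α, ‖(Φ i).coeff α‖ = 1 := by
  have hle : ∀ i α, ‖(Φ i).coeff α‖ ≤ coeffNorm Φ := by
    intro i α
    by_cases h : α ∈ (Φ i).support
    · refine NNReal.coe_le_coe.2 (?_ : ‖(Φ i).coeff α‖₊ ≤ _)
      exact (Finset.le_sup (f := fun α => ‖(Φ i).coeff α‖₊) h).trans
        (Finset.le_sup (f := fun i => (Φ i).support.sup fun α => ‖(Φ i).coeff α‖₊)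
          (Finset.mem_univ i))
    · rw [notMem_support_iff.1 h, norm_zero]
      exact NNReal.coe_nonneg _
  have hub : ∀ r : NNReal, (∀ i α, ‖(Φ i).coeff α‖ ≤ r) → coeffNorm Φ ≤ r := fun r hr =>
    NNReal.coe_le_coe.2 (Finset.sup_le fun i _ => Finset.sup_le fun α _ => hr i α)
  constructor
  · intro h
    refine ⟨fun i α => h ▸ hle i α, ?_⟩
    obtain ⟨i, -, hi⟩ := Finset.exists_mem_eq_sup Finset.univ Finset.univ_nonempty
      fun i => (Φ i).support.sup fun α => ‖(Φ i).coeff α‖₊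
    have h1 : ((Φ i).support.sup fun α => ‖(Φ i).coeff α‖₊) = 1 := by
      rw [← hi]
      exact NNReal.coe_eq_one.1 h
    -- The supremum over an empty support is 0, which excludes a zero component here.
    have hne : (Φ i).support.Nonempty := by
      rw [Finset.nonempty_iff_ne_empty]
      intro h0
      rw [h0, Finset.sup_empty] at h1
      exact zero_ne_one h1
    obtain ⟨α, -, hα⟩ := Finset.exists_mem_eq_sup _ hne fun α => ‖(Φ i).coeff α‖₊
    have hα1 : ‖(Φ i).coeff α‖₊ = 1 := hα.symm.trans h1
    exact ⟨i, α, by rw [← coe_nnnorm, hα1, NNReal.coe_one]⟩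
  · rintro ⟨h1, i, α, h2⟩
    exact le_antisymm (hub 1 h1) (h2 ▸ hle i α)

theorem isMinimalLift_iff {φ : ProjMorphism K N d} :
    IsMinimalLift φ Φ ↔ IsLift d Φ φ.toFun ∧ coeffNorm Φ = 1 := by
  rw [coeffNorm_eq_one_iff, IsMinimalLift]

variable [IsUltrametricDist K]

theorem norm_evalMap_le_one (hΦ : ∀ i α, ‖(Φ i).coeff α‖ ≤ 1) {x : Fin (N + 1) → K}
    (hx : ‖x‖ ≤ 1) : ‖evalMap Φ x‖ ≤ 1 :=
  (pi_norm_le_iff_of_nonneg zero_le_one).2 fun i => norm_eval_le_one (hΦ i) hx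

theorem norm_evalMap_sub_le (hΦ : ∀ i α, ‖(Φ i).coeff α‖ ≤ 1) {x y : Fin (N + 1) → K}
    (hx : ‖x‖ ≤ 1) (hy : ‖y‖ ≤ 1) : ‖evalMap Φ x - evalMap Φ y‖ ≤ ‖x - y‖ :=
  (pi_norm_le_iff_of_nonneg (norm_nonneg _)).2 fun i => norm_eval_sub_eval_le (hΦ i) hx hy

/-- A coordinate of Φ(x) of norm 1 changes by less than 1, so it keeps norm 1. Equivalently, the
condition depends only on x modulo the maximal ideal. -/
theorem norm_evalMap_eq_one_of_norm_sub_lt (hΦ : ∀ i α, ‖(Φ i).coeff α‖ ≤ 1)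
    {x y : Fin (N + 1) → K} (hx : ‖x‖ ≤ 1) (hy : ‖y‖ ≤ 1) (hxy : ‖x - y‖ < 1)
    (h : ‖evalMap Φ x‖ = 1) : ‖evalMap Φ y‖ = 1 := by
  obtain ⟨i, hi⟩ := exists_norm_apply_eq (evalMap Φ x)
  refine le_antisymm (norm_evalMap_le_one hΦ hy) ?_
  by_contra! hlt
  have h1 : ‖evalMap Φ x i‖ ≤ max ‖evalMap Φ x i - evalMap Φ y i‖ ‖evalMap Φ y i‖ := by
    simpa using IsUltrametricDist.norm_add_le_max (evalMap Φ x i - evalMap Φ y i) (evalMap Φ y i)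
  rw [hi, h] at h1
  refine h1.not_gt (max_lt ?_ ((norm_le_pi_norm _ i).trans_lt hlt))
  exact ((norm_le_pi_norm (evalMap Φ x - evalMap Φ y) i).trans
    (norm_evalMap_sub_le hΦ hx hy)).trans_lt hxy

end Lifts

/-! ### Normalized representatives and unit disks -/

section Disks

variable {K : Type*} [NormedField K] {N d : ℕ}

theorem exists_normalized (P : PSpace K N) : ∃ (x : Fin (N + 1) → K) (hx : x ≠ 0)
    (j : Fin (N + 1)), Projectivization.mk K x hx = P ∧ ‖x‖ = 1 ∧ x j = 1 := by
  obtain ⟨j, hj⟩ := exists_norm_apply_eq P.rep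
  have hP := norm_ne_zero_iff.2 P.rep_nonzero
  have hj0 : P.rep j ≠ 0 := norm_ne_zero_iff.1 (hj ▸ hP)
  have hn : ‖(P.rep j)⁻¹ • P.rep‖ = 1 := by
    rw [norm_smul, norm_inv, hj, inv_mul_cancel₀ hP]
  have hne : (P.rep j)⁻¹ • P.rep ≠ 0 := smul_ne_zero (inv_ne_zero hj0) P.rep_nonzero
  refine ⟨(P.rep j)⁻¹ • P.rep, hne, j, ?_, hn, by simp [hj0]⟩
  conv_rhs => rw [← P.mk_rep]
  exact (Projectivization.mk_eq_mk_iff' K _ _ _ _).2 ⟨_, rfl⟩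

/-- When both j-th coordinates are 1, the minor at (i, j) is exactly x_i - y_i. -/
theorem norm_sub_le_chordalAux {x y : Fin (N + 1) → K} {j : Fin (N + 1)} (hx : ‖x‖ = 1)
    (hy : ‖y‖ = 1) (hxj : x j = 1) (hyj : y j = 1) : ‖x - y‖ ≤ chordalAux x y := by
  refine (pi_norm_le_iff_of_nonneg ?_).2 fun i => ?_
  · unfold chordalAux; positivity
  · simpa [hx, hy, hxj, hyj] using le_chordalAux x y i j

/-- A point at distance less than `1` from `P` is normalized at the same coordinate. -/
theorem exists_normalized_of_mem_disk [IsUltrametricDist K] {x : Fin (N + 1) → K} (hx0 : x ≠ 0)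
    {j : Fin (N + 1)}
    (hx : ‖x‖ = 1) (hxj : x j = 1) {Q : PSpace K N}
    (hQ : Q ∈ disk (Projectivization.mk K x hx0) 1) : ∃ (y : Fin (N + 1) → K) (hy : y ≠ 0),
      Projectivization.mk K y hy = Q ∧ ‖y‖ = 1 ∧ y j = 1 ∧ ‖x - y‖ < 1 := by
  obtain ⟨y, hy0, i, rfl, hy, hyi⟩ := exists_normalized Q
  rw [disk, Set.mem_ofPred_eq, chordalDist_mk] at hQ
  -- The minor at (i, j), where x_j = 1 and y_i = 1. It forces |x_i y_j| = 1, hence |y_j| = 1, and y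
  -- can be rescaled to be 1 at j.
  have hlt : ‖x i * y j - 1‖ < 1 := by
    have := le_chordalAux x y i j
    rw [hxj, hyi, hx, hy, mul_one, mul_one, mul_one] at this
    exact this.trans_lt hQ
  have hyj : ‖y j‖ = 1 := by
    refine le_antisymm (hy ▸ norm_le_pi_norm y j) ?_
    by_contra! hlt'
    have h1 : ‖(1 : K)‖ ≤ max ‖x i * y j‖ ‖x i * y j - 1‖ := by
      simpa [norm_sub_rev] using
        IsUltrametricDist.norm_add_le_max (x i * y j) (1 - x i * y j)
    rw [norm_one, norm_mul] at h1
    refine h1.not_gt (max_lt ?_ hlt)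
    exact (mul_le_of_le_one_left (norm_nonneg _) (hx ▸ norm_le_pi_norm x i)).trans_lt hlt'
  have hyj0 : y j ≠ 0 := norm_ne_zero_iff.1 (by rw [hyj]; exact one_ne_zero)
  have hy1 : ‖(y j)⁻¹ • y‖ = 1 := by rw [norm_smul, norm_inv, hyj, hy, inv_one, one_mul]
  have hne : (y j)⁻¹ • y ≠ 0 := smul_ne_zero (inv_ne_zero hyj0) hy0
  have hmk : Projectivization.mk K _ hne = Projectivization.mk K y hy0 :=
    (Projectivization.mk_eq_mk_iff' K _ _ _ _).2 ⟨_, rfl⟩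
  have hj1 : ((y j)⁻¹ • y) j = 1 := by simp [hyj0]
  refine ⟨_, hne, hmk, hy1, hj1, (norm_sub_le_chordalAux hx hy1 hxj hj1).trans_lt ?_⟩
  rw [← chordalDist_mk x _ hx0 hne, hmk, chordalDist_mk]
  exact hQ

end Disks

/-! ### The good locus -/

section GoodLocus

theorem mem_goodLocus_of_isMinimalLift {K : Type*} [NormedField K] {N d : ℕ}
    {φ : ProjMorphism K N d} {Φ : Fin (N + 1) → MvPolynomial (Fin (N + 1)) K}
    (hΦ : IsMinimalLift φ Φ) {x : Fin (N + 1) → K} (hx0 : x ≠ 0) (hx : ‖x‖ = 1)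
    (h : ‖evalMap Φ x‖ = 1) : Projectivization.mk K x hx0 ∈ goodLocus φ :=
  ⟨Φ, hΦ.1, x, hx0, rfl, hx, (isMinimalLift_iff.1 hΦ).2, h⟩

/-- Good reduction can be tested with any minimal lift and any normalized representative. -/
theorem mem_goodLocus_iff {K : Type*} [NormedField K] [IsAlgClosed K] {N d : ℕ} (hd : d ≠ 0)
    {φ : ProjMorphism K N d} {Φ : Fin (N + 1) → MvPolynomial (Fin (N + 1)) K}
    (hΦ : IsMinimalLift φ Φ) {x : Fin (N + 1) → K} (hx0 : x ≠ 0) (hx : ‖x‖ = 1) :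
    Projectivization.mk K x hx0 ∈ goodLocus φ ↔ ‖evalMap Φ x‖ = 1 := by
  refine ⟨?_, mem_goodLocus_of_isMinimalLift hΦ hx0 hx⟩
  rintro ⟨Ψ, hΨ, y, hy0, hyx, hy, hΨ1, hΨy⟩
  obtain ⟨c, hc⟩ := hΦ.1.exists_eq_C_mul hd hΨ
  obtain ⟨a, rfl⟩ := (Projectivization.mk_eq_mk_iff' K _ _ _ _).1 hyx
  have ha : ‖a‖ = 1 := by rwa [norm_smul, hx, mul_one] at hy
  have hcoeff : ∀ i α, ‖(Ψ i).coeff α‖ = ‖c‖ * ‖(Φ i).coeff α‖ := fun i α => by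
    rw [hc, coeff_C_mul, norm_mul]
  obtain ⟨hΨle, i, α, hi⟩ := coeffNorm_eq_one_iff.1 hΨ1
  obtain ⟨hlift, hΦle, j, β, hj⟩ := hΦ
  -- A unit coefficient of Φ bounds |c| above, and a unit coefficient of Ψ bounds it below.
  have hc1 : ‖c‖ = 1 := by
    refine le_antisymm ?_ ?_
    · simpa [hcoeff, hj] using hΨle j β
    · rw [← hi, hcoeff]
      exact mul_le_of_le_one_right (norm_nonneg _) (hΦle i α)
  have hev : evalMap Ψ (a • x) = c • a ^ d • evalMap Φ x := by
    rw [← evalMap_smul hlift.1]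
    funext l
    simp [evalMap, hc]
  rwa [hev, norm_smul, norm_smul, norm_pow, ha, hc1, one_pow, one_mul, one_mul] at hΨy

theorem gFun_eq_zero_iff {K : Type*} [NormedField K] {N d : ℕ} (hd : d ≠ 0)
    {φ : ProjMorphism K N d} {Φ : Fin (N + 1) → MvPolynomial (Fin (N + 1)) K}
    (hΦ : IsLift d Φ φ.toFun) {x : Fin (N + 1) → K} (hx0 : x ≠ 0) (hx : ‖x‖ = 1) :
    gFun d Φ (Projectivization.mk K x hx0) = 0 ↔ ‖evalMap Φ x‖ = 1 := by
  -- Since `Real.log 0 = 0`, a vanishing logarithm gives norm 1 only once norm 0 is excluded.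
  have hpos := norm_pos_iff.2 (hΦ.evalMap_ne_zero hx0)
  rw [gFun_mk hd hΦ, hx, Real.log_one, sub_zero, mul_eq_zero_iff_left
    (one_div_ne_zero (Nat.cast_ne_zero.2 hd))]
  refine ⟨Real.eq_one_of_pos_of_log_eq_zero hpos, fun h => by rw [h, Real.log_one]⟩

theorem disk_mono {K : Type*} [NormedField K] {N : ℕ} (P : PSpace K N) {r s : ℝ} (h : r ≤ s) :
    disk P r ⊆ disk P s := fun _ hQ => lt_of_lt_of_le hQ h

theorem disk_mem_nhds {K : Type*} [NormedField K] [IsUltrametricDist K] {N : ℕ}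
    (P : PSpace K N) {r : ℝ} (hr : 0 < r) : disk P r ∈ nhds P := by
  convert Metric.ball_mem_nhds P hr using 1
  ext Q
  rw [Metric.mem_ball, dist_comm]
  rfl

variable {K : Type*} [NormedField K] [IsUltrametricDist K] {N d : ℕ}
  {φ : ProjMorphism K N d} {Φ : Fin (N + 1) → MvPolynomial (Fin (N + 1)) K}
  {x : Fin (N + 1) → K} {j : Fin (N + 1)}

theorem disk_one_subset_goodLocus (hΦ : IsMinimalLift φ Φ) (hx0 : x ≠ 0) (hx : ‖x‖ = 1)
    (hxj : x j = 1) (h : ‖evalMap Φ x‖ = 1) :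
    disk (Projectivization.mk K x hx0) 1 ⊆ goodLocus φ := by
  intro Q hQ
  obtain ⟨y, hy0, rfl, hy, -, hxy⟩ := exists_normalized_of_mem_disk hx0 hx hxj hQ
  exact mem_goodLocus_of_isMinimalLift hΦ hy0 hy
    (norm_evalMap_eq_one_of_norm_sub_lt hΦ.2.1 hx.le hy.le hxy h)

/-- On D_1(P) the images Φ(y), Φ(z) are already unit vectors, so no denominator enlarges the
distance, and the estimate reduces to Φ being nonexpanding. -/
theorem nonexpandingOn_disk_one (hΦ : IsMinimalLift φ Φ) (hx0 : x ≠ 0) (hx : ‖x‖ = 1)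
    (hxj : x j = 1) (h : ‖evalMap Φ x‖ = 1) :
    NonexpandingOn φ (disk (Projectivization.mk K x hx0) 1) := by
  intro Q hQ R hR
  obtain ⟨y, hy0, rfl, hy, hyj, hxy⟩ := exists_normalized_of_mem_disk hx0 hx hxj hQ
  obtain ⟨z, hz0, rfl, hz, hzj, hxz⟩ := exists_normalized_of_mem_disk hx0 hx hxj hR
  obtain ⟨hΦy0, hφy⟩ := hΦ.1.2 y hy0
  obtain ⟨hΦz0, hφz⟩ := hΦ.1.2 z hz0
  have hΦy := norm_evalMap_eq_one_of_norm_sub_lt hΦ.2.1 hx.le hy.le hxy h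
  have hΦz := norm_evalMap_eq_one_of_norm_sub_lt hΦ.2.1 hx.le hz.le hxz h
  have hle : ‖evalMap Φ y - evalMap Φ z‖ ≤ chordalAux y z :=
    (norm_evalMap_sub_le hΦ.2.1 hy.le hz.le).trans (norm_sub_le_chordalAux hy hz hyj hzj)
  rw [hφy, hφz, chordalDist_mk, chordalDist_mk]
  refine le_trans ?_ hle
  rw [chordalAux, hΦy, hΦz, mul_one, div_one]
  refine (pi_norm_le_iff_of_nonneg (norm_nonneg _)).2 fun p => ?_
  set u := evalMap Φ y
  set v := evalMap Φ z
  -- The minors of v with itself vanish, so u may be replaced by u - v.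
  rw [show u p.1 * v p.2 - u p.2 * v p.1 = (u - v) p.1 * v p.2 - (u - v) p.2 * v p.1 by
    simp only [Pi.sub_apply]; ring]
  have hterm : ∀ a b, ‖(u - v) a * v b‖ ≤ ‖u - v‖ := fun a b => by
    rw [norm_mul]
    exact (mul_le_of_le_one_right (norm_nonneg _) (hΦz ▸ norm_le_pi_norm v b)).trans
      (norm_le_pi_norm (u - v) a)
  rw [sub_eq_add_neg]
  refine (IsUltrametricDist.norm_add_le_max _ _).trans (max_le (hterm _ _) ?_)
  rw [norm_neg]
  exact hterm _ _

theorem isOpen_goodLocus [IsAlgClosed K] (hd : d ≠ 0) (φ : ProjMorphism K N d) :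
    IsOpen (goodLocus φ) := by
  refine isOpen_iff_mem_nhds.2 fun P hP => ?_
  -- The point of good reduction itself supplies a minimal lift.
  obtain ⟨Φ, hΦ, -, -, -, -, hΦ1, -⟩ := id hP
  have hmin : IsMinimalLift φ Φ := isMinimalLift_iff.2 ⟨hΦ, hΦ1⟩
  obtain ⟨x, hx0, j, rfl, hx, hxj⟩ := exists_normalized P
  exact Filter.mem_of_superset (disk_mem_nhds _ one_pos)
    (disk_one_subset_goodLocus hmin hx0 hx hxj ((mem_goodLocus_iff hd hmin hx0 hx).1 hP))

end GoodLocus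

end GoodReduction

/-! ### The equivalences, the nonexpanding property and openness -/

theorem proposition31 {K : Type*} [NontriviallyNormedField K] [IsUltrametricDist K]
    [CompleteSpace K] [IsAlgClosed K] (N d : ℕ) (hd : 2 ≤ d) (φ : ProjMorphism K N d) :
    (∀ Φ : Fin (N + 1) → MvPolynomial (Fin (N + 1)) K, IsMinimalLift φ Φ →
      ∀ ρ : K, IsMinimalResultant φ ρ → ∀ P : PSpace K N,
        (P ∈ goodLocus φ ↔ disk P ‖ρ‖ ⊆ goodLocus φ) ∧
        (disk P ‖ρ‖ ⊆ goodLocus φ ↔ gFun d Φ P = 0) ∧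
        (gFun d Φ P = 0 → NonexpandingOn φ (disk P ‖ρ‖)) ∧
        (NonexpandingOn φ (disk P ‖ρ‖) → ∃ U ∈ nhds P, NonexpandingOn φ U)) ∧
    IsOpen (goodLocus φ) := by
  have hd0 : d ≠ 0 := by omega
  refine ⟨?_, isOpen_goodLocus hd0 φ⟩
  -- The minimal lift Ψ computing the resultant may differ from Φ; this is harmless, as only 0 <
  -- |Res(Ψ)| ≤ 1 matters.
  rintro Φ hΦ _ ⟨Ψ, hΨ, rfl⟩ P
  have hpos : 0 < ‖resultant d Ψ‖ := norm_pos_iff.2 hΨ.1.resultant_ne_zero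
  have hmono := disk_mono P (norm_resultant_le_one (d := d) hΨ.2.1)
  have hnhds := disk_mem_nhds P hpos
  obtain ⟨x, hx0, j, rfl, hx, hxj⟩ := exists_normalized P
  have hgood := mem_goodLocus_iff hd0 hΦ hx0 hx
  have hg := gFun_eq_zero_iff hd0 hΦ.1 hx0 hx
  have hab : Projectivization.mk K x hx0 ∈ goodLocus φ ↔
      disk (Projectivization.mk K x hx0) ‖resultant d Ψ‖ ⊆ goodLocus φ :=
    ⟨fun h => hmono.trans (disk_one_subset_goodLocus hΦ hx0 hx hxj (hgood.1 h)),
      fun h => h (mem_of_mem_nhds hnhds)⟩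
  refine ⟨hab, hab.symm.trans (hgood.trans hg.symm), fun h Q hQ R hR => ?_,
    fun h => ⟨_, hnhds, h⟩⟩
  exact nonexpandingOn_disk_one hΦ hx0 hx hxj (hg.1 h) Q (hmono hQ) R (hmono hR)
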